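/- For $z=(x,\omega)\in\mathbb R^{2d}$ let $\pi(z)$ be the unitary operator on $L^2(\mathbb R^d)$ given by $\pi(z)\psi(t)=e^{2\pi i\,\omega\cdot t}\psi(t-x)$. For $f\in L^1(\mathbb R^{2d})$ and a trace class operator $S$ on $L^2(\mathbb R^d)$ let $f\star S=\int_{\mathbb R^{2d}}f(z)\,\pi(z)S\pi(z)^*\,dz$, where the integral is understood weakly, i.e. $\langle (f\star S)\psi,\xi\rangle=\int_{\mathbb R^{2d}} f(z)\langle \pi(z)S\pi(z)^*\psi,\xi\rangle\,dz$ for all $\psi,\xi\in L^2(\mathbb R^d)$. A density operator is a positive trace class operator of trace $1$; $\chi_A$ denotes the characteristic function of a set $A$, $|A|$ its Lebesgue measure, and $RA=\{Rz:z\in A\}$. **Theorem.** Let $S$ be a density operator on $L^2(\mathbb R^d)$, let $\Omega\subset\mathbb R^{2d}$ be a compact set with $|\Omega|>0$, and let $\delta\in(0,1)$. For $R>0$ let $\{\lambda_k^{R\Omega}\}_k$ be the eigenvalues of $\chi_{R\Omega}\star S$, counted with multiplicity. Then $\#\{k:\lambda_k^{R\Omega}>1-\delta\}$ is finite for every $R>0$,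 and $$\frac{\#\{k:\lambda_k^{R\Omega}>1-\delta\}}{R^{2d}|\Omega|}\longrightarrow 1\qquad\text{as }R\to\infty.$$ -/

import Mathlib

open MeasureTheory Filter Topology
open scoped ENNReal Pointwise

noncomputable section

namespace QHA

/-- Configuration space `ℝ^d`, with its Euclidean inner product and Lebesgue measure. -/
abbrev Config (d : ℕ) : Type := EuclideanSpace ℝ (Fin d)

/-- Phase space `ℝ^{2d}`: points `z = (x, ω)`, with Lebesgue measure. -/
abbrev Phase (d : ℕ) : Type := Config d × Config d

/-- The Hilbert space `L²(ℝ^d)` of complex-valued functions. -/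
abbrev L2 (d : ℕ) : Type := Lp ℂ 2 (volume : Measure (Config d))

variable {d : ℕ}

/-! ### Time-frequency shifts -/

/-- The translation `T_x ψ(t) = ψ(t - x)`, as a linear isometry of `L²(ℝ^d)`. -/
def translationAux (x : Config d) : L2 d →ₗᵢ[ℂ] L2 d :=
  Lp.compMeasurePreservingₗᵢ ℂ (fun t : Config d => t - x) (measurePreserving_sub_right volume x)

theorem coeFn_translationAux (x : Config d) (ψ : L2 d) :
    translationAux x ψ =ᵐ[volume] fun t => ψ (t - x) :=
  Lp.coeFn_compMeasurePreserving ψ (measurePreserving_sub_right volume x)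

theorem translationAux_neg_cancel (x : Config d) (ψ : L2 d) :
    translationAux x (translationAux (-x) ψ) = ψ := by
  apply Lp.ext
  have h1 := coeFn_translationAux x (translationAux (-x) ψ)
  have h2 := (measurePreserving_sub_right (volume : Measure (Config d)) x).quasiMeasurePreserving.ae
    (coeFn_translationAux (-x) ψ)
  filter_upwards [h1, h2] with t h1 h2
  rw [h1, h2]
  simp

/-- The translation operator `T_x ψ(t) = ψ(t - x)`, a unitary operator on `L²(ℝ^d)`. -/
def translation (x : Config d) : L2 d ≃ₗᵢ[ℂ] L2 d :=
  LinearIsometryEquiv.mk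
    (LinearEquiv.ofLinearMap (translationAux x).toLinearMap (translationAux (-x)).toLinearMap
      (LinearMap.ext fun ψ => translationAux_neg_cancel x ψ)
      (LinearMap.ext fun ψ => by
        have h := translationAux_neg_cancel (-x) ψ
        rwa [neg_neg] at h))
    (fun ψ => (translationAux x).norm_map ψ)

theorem coeFn_translation (x : Config d) (ψ : L2 d) :
    translation x ψ =ᵐ[volume] fun t => ψ (t - x) :=
  coeFn_translationAux x ψ

/-- The phase factor `e^{2πi ω·t}`. -/
def phaseFactor (ω t : Config d) : ℂ := Complex.exp (2 * Real.pi * Complex.I * (inner ℝ ω t : ℝ))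

theorem norm_phaseFactor (ω t : Config d) : ‖phaseFactor ω t‖ = 1 := by
  have h : (2 * Real.pi * Complex.I * (inner ℝ ω t : ℝ) : ℂ)
      = ((2 * Real.pi * inner ℝ ω t : ℝ) : ℂ) * Complex.I := by
    push_cast; ring
  rw [phaseFactor, h, Complex.norm_exp_ofReal_mul_I]

theorem continuous_phaseFactor : Continuous fun p : Config d × Config d => phaseFactor p.1 p.2 := by
  unfold phaseFactor
  fun_prop

theorem phaseFactor_mul_neg (ω t : Config d) : phaseFactor ω t * phaseFactor (-ω) t = 1 := by
  rw [phaseFactor, phaseFactor, ← Complex.exp_add]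
  simp

theorem memLp_phaseFactor_mul (ω : Config d) (ψ : L2 d) :
    MemLp (fun t => phaseFactor ω t * ψ t) 2 (volume : Measure (Config d)) := by
  refine (Lp.memLp ψ).of_le ?_ (Eventually.of_forall fun t => ?_)
  · exact (continuous_phaseFactor.comp (Continuous.prodMk_right ω)).aestronglyMeasurable.mul
      (Lp.aestronglyMeasurable ψ)
  · rw [norm_mul, norm_phaseFactor, one_mul]

/-- The modulation `M_ω ψ(t) = e^{2πi ω·t} ψ(t)`, as a linear isometry of `L²(ℝ^d)`. -/
def modulationAux (ω : Config d) : L2 d →ₗᵢ[ℂ] L2 d where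
  toFun ψ := (memLp_phaseFactor_mul ω ψ).toLp _
  map_add' ψ ξ := by
    rw [← MemLp.toLp_add]
    apply MemLp.toLp_congr
    filter_upwards [Lp.coeFn_add ψ ξ] with t h
    simp only [h, Pi.add_apply, mul_add]
  map_smul' c ψ := by
    rw [RingHom.id_apply, ← MemLp.toLp_const_smul]
    apply MemLp.toLp_congr
    filter_upwards [Lp.coeFn_smul c ψ] with t h
    simp only [h, Pi.smul_apply, smul_eq_mul]
    ring
  norm_map' ψ := by
    change ‖(memLp_phaseFactor_mul ω ψ).toLp _‖ = ‖ψ‖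
    rw [Lp.norm_toLp, Lp.norm_def]
    congr 1
    refine eLpNorm_congr_norm_ae (Eventually.of_forall fun t => ?_)
    rw [norm_mul, norm_phaseFactor, one_mul]

theorem coeFn_modulationAux (ω : Config d) (ψ : L2 d) :
    modulationAux ω ψ =ᵐ[volume] fun t => phaseFactor ω t * ψ t :=
  MemLp.coeFn_toLp (memLp_phaseFactor_mul ω ψ)

theorem modulationAux_neg_cancel (ω : Config d) (ψ : L2 d) :
    modulationAux ω (modulationAux (-ω) ψ) = ψ := by
  apply Lp.ext
  filter_upwards [coeFn_modulationAux ω (modulationAux (-ω) ψ), coeFn_modulationAux (-ω) ψ]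
    with t h1 h2
  rw [h1, h2, ← mul_assoc, phaseFactor_mul_neg, one_mul]

/-- The modulation operator `M_ω ψ(t) = e^{2πi ω·t} ψ(t)`, a unitary operator on `L²(ℝ^d)`. -/
def modulation (ω : Config d) : L2 d ≃ₗᵢ[ℂ] L2 d :=
  LinearIsometryEquiv.mk
    (LinearEquiv.ofLinearMap (modulationAux ω).toLinearMap (modulationAux (-ω)).toLinearMap
      (LinearMap.ext fun ψ => modulationAux_neg_cancel ω ψ)
      (LinearMap.ext fun ψ => by
        have h := modulationAux_neg_cancel (-ω) ψ
        rwa [neg_neg] at h))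
    (fun ψ => (modulationAux ω).norm_map ψ)

theorem coeFn_modulation (ω : Config d) (ψ : L2 d) :
    modulation ω ψ =ᵐ[volume] fun t => phaseFactor ω t * ψ t :=
  coeFn_modulationAux ω ψ

/-- The time-frequency shift `π(z) = M_ω T_x` for `z = (x, ω)`. -/
def timeFreqShift (z : Phase d) : L2 d ≃ₗᵢ[ℂ] L2 d :=
  (translation z.1).trans (modulation z.2)

/-- The shift `α_z(A) = π(z) A π(z)^*` of a bounded operator `A` on `L²(ℝ^d)`. -/
def opShift (z : Phase d) (A : L2 d →L[ℂ] L2 d) : L2 d →L[ℂ] L2 d :=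
  (timeFreqShift z : L2 d →L[ℂ] L2 d) ∘L A ∘L
    ContinuousLinearMap.adjoint (timeFreqShift z : L2 d →L[ℂ] L2 d)

theorem opShift_apply (z : Phase d) (A : L2 d →L[ℂ] L2 d) (ψ : L2 d) :
    opShift z A ψ = timeFreqShift z (A ((timeFreqShift z).symm ψ)) := by
  simp [opShift, LinearIsometryEquiv.adjoint_eq_symm]

/-! ### Strong continuity of the time-frequency shifts -/

theorem continuous_translation (ψ : L2 d) : Continuous fun x : Config d => translation x ψ := by
  let g : Config d → C(Config d, Config d) := fun x => ⟨fun t => t - x, by fun_prop⟩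
  have hg : Continuous g := by
    apply ContinuousMap.continuous_of_continuous_uncurry
    change Continuous fun p : Config d × Config d => p.2 - p.1
    fun_prop
  exact Continuous.compMeasurePreservingLp (f := fun _ => ψ) continuous_const hg
    (fun x => measurePreserving_sub_right volume x) (by norm_num)

theorem continuous_modulation (ψ : L2 d) : Continuous fun ω : Config d => modulation ω ψ := by
  rw [continuous_iff_continuousAt]
  intro ω₀
  rw [ContinuousAt, tendsto_iff_norm_sub_tendsto_zero]
  have key : Tendsto (fun ω : Config d => ‖modulation ω ψ - modulation ω₀ ψ‖ ^ 2) (𝓝 ω₀) (𝓝 0) := by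
    have hrep : ∀ ω : Config d, ‖modulation ω ψ - modulation ω₀ ψ‖ ^ 2
        = ∫ t, ‖phaseFactor ω t - phaseFactor ω₀ t‖ ^ 2 * ‖ψ t‖ ^ 2 := by
      intro ω
      rw [@norm_sq_eq_re_inner ℂ, L2.inner_def]
      have : ∀ᵐ t ∂(volume : Measure (Config d)),
          inner ℂ ((modulation ω ψ - modulation ω₀ ψ : L2 d) t)
            ((modulation ω ψ - modulation ω₀ ψ : L2 d) t)
          = ((‖phaseFactor ω t - phaseFactor ω₀ t‖ ^ 2 * ‖ψ t‖ ^ 2 : ℝ) : ℂ) := by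
        filter_upwards [Lp.coeFn_sub (modulation ω ψ) (modulation ω₀ ψ),
          coeFn_modulation ω ψ, coeFn_modulation ω₀ ψ] with t h h1 h2
        rw [h, Pi.sub_apply, h1, h2, ← sub_mul, inner_self_eq_norm_sq_to_K, norm_mul]
        push_cast
        rw [mul_pow]
        rfl
      rw [integral_congr_ae this, integral_complex_ofReal]
      exact RCLike.ofReal_re _
    simp_rw [hrep]
    have h0 : (0 : ℝ) = ∫ t : Config d, (0 : ℝ) := by simp
    rw [h0]
    have hint : Integrable (fun t => ‖ψ t‖ ^ 2) (volume : Measure (Config d)) :=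
      (Lp.memLp ψ).integrable_norm_pow (by norm_num)
    refine tendsto_integral_filter_of_dominated_convergence (fun t => 4 * ‖ψ t‖ ^ 2) ?_ ?_
      (hint.const_mul 4) ?_
    · refine Eventually.of_forall fun ω => ?_
      refine AEStronglyMeasurable.mul (Continuous.aestronglyMeasurable ?_) hint.aestronglyMeasurable
      have h1 := continuous_phaseFactor.comp (Continuous.prodMk_right ω)
      have h2 := continuous_phaseFactor.comp (Continuous.prodMk_right ω₀)
      exact ((h1.sub h2).norm).pow 2
    · refine Eventually.of_forall fun ω => Eventually.of_forall fun t => ?_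
      have h1 : ‖phaseFactor ω t - phaseFactor ω₀ t‖ ≤ 2 := by
        refine (norm_sub_le _ _).trans ?_
        rw [norm_phaseFactor, norm_phaseFactor]
        norm_num
      have h2 : ‖phaseFactor ω t - phaseFactor ω₀ t‖ ^ 2 ≤ 4 := by
        nlinarith [norm_nonneg (phaseFactor ω t - phaseFactor ω₀ t)]
      rw [Real.norm_of_nonneg (by positivity)]
      gcongr
    · refine Eventually.of_forall fun t => ?_
      have h1 : Continuous fun ω : Config d => phaseFactor ω t :=
        continuous_phaseFactor.comp (Continuous.prodMk_left t)
      have h2 : Continuous fun ω : Config d =>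
          ‖phaseFactor ω t - phaseFactor ω₀ t‖ ^ 2 * ‖ψ t‖ ^ 2 := by fun_prop
      have h3 := h2.tendsto ω₀
      simpa using h3
  have h := key.sqrt
  simpa [Real.sqrt_sq] using h

theorem continuous_timeFreqShift (ψ : L2 d) : Continuous fun z : Phase d => timeFreqShift z ψ := by
  rw [continuous_iff_continuousAt]
  intro z₀
  rw [ContinuousAt, tendsto_iff_norm_sub_tendsto_zero]
  have h1 : Tendsto (fun z : Phase d => ‖translation z.1 ψ - translation z₀.1 ψ‖) (𝓝 z₀) (𝓝 0) := by
    rw [← tendsto_iff_norm_sub_tendsto_zero]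
    exact ((continuous_translation ψ).comp continuous_fst).tendsto z₀
  have h2 : Tendsto (fun z : Phase d => ‖modulation z.2 (translation z₀.1 ψ)
      - modulation z₀.2 (translation z₀.1 ψ)‖) (𝓝 z₀) (𝓝 0) := by
    rw [← tendsto_iff_norm_sub_tendsto_zero]
    exact ((continuous_modulation (translation z₀.1 ψ)).comp continuous_snd).tendsto z₀
  refine squeeze_zero (fun _ => norm_nonneg _) (fun z => ?_) (by simpa using h1.add h2)
  change ‖modulation z.2 (translation z.1 ψ) - modulation z₀.2 (translation z₀.1 ψ)‖ ≤ _
  refine (norm_sub_le_norm_sub_add_norm_sub _ (modulation z.2 (translation z₀.1 ψ)) _).trans ?_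
  rw [← map_sub, LinearIsometryEquiv.norm_map]

theorem continuous_timeFreqShift_symm (ψ : L2 d) :
    Continuous fun z : Phase d => (timeFreqShift z).symm ψ := by
  rw [continuous_iff_continuousAt]
  intro z₀
  rw [ContinuousAt, tendsto_iff_norm_sub_tendsto_zero]
  have h : Tendsto (fun z : Phase d => ‖timeFreqShift z ((timeFreqShift z₀).symm ψ)
      - timeFreqShift z₀ ((timeFreqShift z₀).symm ψ)‖) (𝓝 z₀) (𝓝 0) := by
    rw [← tendsto_iff_norm_sub_tendsto_zero]
    exact (continuous_timeFreqShift _).tendsto z₀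
  refine h.congr fun z => ?_
  rw [LinearIsometryEquiv.apply_symm_apply, ← (timeFreqShift z).norm_map
    ((timeFreqShift z).symm ψ - (timeFreqShift z₀).symm ψ), map_sub,
    LinearIsometryEquiv.apply_symm_apply, norm_sub_rev]

theorem continuous_opShift (A : L2 d →L[ℂ] L2 d) (ψ : L2 d) :
    Continuous fun z : Phase d => opShift z A ψ := by
  simp_rw [opShift_apply]
  rw [continuous_iff_continuousAt]
  intro z₀
  rw [ContinuousAt, tendsto_iff_norm_sub_tendsto_zero]
  have h1 : Tendsto (fun z : Phase d => ‖A ((timeFreqShift z).symm ψ)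
      - A ((timeFreqShift z₀).symm ψ)‖) (𝓝 z₀) (𝓝 0) := by
    rw [← tendsto_iff_norm_sub_tendsto_zero]
    exact (A.continuous.comp (continuous_timeFreqShift_symm ψ)).tendsto z₀
  have h2 : Tendsto (fun z : Phase d => ‖timeFreqShift z (A ((timeFreqShift z₀).symm ψ))
      - timeFreqShift z₀ (A ((timeFreqShift z₀).symm ψ))‖) (𝓝 z₀) (𝓝 0) := by
    rw [← tendsto_iff_norm_sub_tendsto_zero]
    exact (continuous_timeFreqShift _).tendsto z₀
  refine squeeze_zero (fun _ => norm_nonneg _) (fun z => ?_) (by simpa using h1.add h2)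
  refine (norm_sub_le_norm_sub_add_norm_sub _
    (timeFreqShift z (A ((timeFreqShift z₀).symm ψ))) _).trans ?_
  rw [← map_sub, LinearIsometryEquiv.norm_map]

theorem norm_opShift_apply_le (z : Phase d) (A : L2 d →L[ℂ] L2 d) (ψ : L2 d) :
    ‖opShift z A ψ‖ ≤ ‖A‖ * ‖ψ‖ := by
  rw [opShift_apply, LinearIsometryEquiv.norm_map]
  exact (A.le_opNorm _).trans (by rw [LinearIsometryEquiv.norm_map])

/-! ### The convolution of a function with an operator -/

theorem integrable_smul_opShift {f : Phase d → ℂ} (hf : Integrable f) (S : L2 d →L[ℂ] L2 d)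
    (ψ : L2 d) : Integrable fun z => f z • opShift z S ψ := by
  refine hf.smul_bdd (‖S‖ * ‖ψ‖)
    (continuous_opShift S ψ).aestronglyMeasurable
    (Eventually.of_forall fun z => norm_opShift_apply_le z S ψ)

/-- The weak integral `∫ f(z) α_z(S) dz` exists, as a unique bounded operator. -/
theorem existsUnique_fnOpConv {f : Phase d → ℂ} (hf : Integrable f) (S : L2 d →L[ℂ] L2 d) :
    ∃! A : L2 d →L[ℂ] L2 d, ∀ ψ ξ : L2 d,
      inner ℂ ξ (A ψ) = ∫ z, f z * inner ℂ ξ (opShift z S ψ) := by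
  let L : L2 d →ₗ[ℂ] L2 d :=
    { toFun := fun ψ => ∫ z, f z • opShift z S ψ
      map_add' := fun ψ ξ => by
        simp_rw [map_add, smul_add]
        exact integral_add (integrable_smul_opShift hf S ψ) (integrable_smul_opShift hf S ξ)
      map_smul' := fun c ψ => by
        simp_rw [map_smul, smul_comm _ c]
        exact integral_smul c _ }
  have hL : ∀ ψ, ‖L ψ‖ ≤ ((∫ z, ‖f z‖) * ‖S‖) * ‖ψ‖ := by
    intro ψ
    rw [mul_assoc, ← integral_mul_const]
    refine norm_integral_le_of_norm_le (hf.norm.mul_const _) (Eventually.of_forall fun z => ?_)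
    rw [norm_smul]
    gcongr
    exact norm_opShift_apply_le z S ψ
  refine ⟨L.mkContinuous _ hL, fun ψ ξ => ?_, fun B hB => ?_⟩
  · change inner ℂ ξ (∫ z, f z • opShift z S ψ) = _
    rw [← integral_inner (integrable_smul_opShift hf S ψ)]
    simp_rw [inner_smul_right]
  · ext1 ψ
    refine ext_inner_left ℂ fun ξ => ?_
    rw [hB]
    change _ = inner ℂ ξ (∫ z, f z • opShift z S ψ)
    rw [← integral_inner (integrable_smul_opShift hf S ψ)]
    simp_rw [inner_smul_right]

/-- The convolution `f ⋆ S = ∫ f(z) α_z(S) dz` of `f ∈ L¹(ℝ^{2d})` with an operator `S`, the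
integral being understood weakly: it is the bounded operator characterized by `inner_fnOpConv`. -/
def fnOpConv (f : Phase d → ℂ) (hf : Integrable f) (S : L2 d →L[ℂ] L2 d) : L2 d →L[ℂ] L2 d :=
  (existsUnique_fnOpConv hf S).choose

theorem inner_fnOpConv (f : Phase d → ℂ) (hf : Integrable f) (S : L2 d →L[ℂ] L2 d) (ψ ξ : L2 d) :
    inner ℂ ξ (fnOpConv f hf S ψ) = ∫ z, f z * inner ℂ ξ (opShift z S ψ) :=
  (existsUnique_fnOpConv hf S).choose_spec.1 ψ ξ

theorem integrable_indicator_one {Ω : Set (Phase d)} (hΩ : IsCompact Ω) :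
    Integrable (Ω.indicator (1 : Phase d → ℂ)) :=
  (integrable_indicator_iff hΩ.measurableSet).2
    (integrableOn_const hΩ.measure_lt_top.ne)

/-- The mixed-state localization operator `χ_Ω ⋆ S` of a compact set `Ω ⊆ ℝ^{2d}`. -/
def locOp (Ω : Set (Phase d)) (hΩ : IsCompact Ω) (S : L2 d →L[ℂ] L2 d) : L2 d →L[ℂ] L2 d :=
  fnOpConv (Ω.indicator 1) (integrable_indicator_one hΩ) S

/-! ### Density operators -/

/-- The trace `∑ₖ ⟨A eₖ, eₖ⟩ ∈ [0, ∞]` of a positive operator `A`, computed in an orthonormal basis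
`(eₖ)` of `L²(ℝ^d)`, which is fixed once and for all (the value does not depend on it). -/
def posTrace (A : L2 d →L[ℂ] L2 d) : ℝ≥0∞ :=
  ∑' k, ENNReal.ofReal (inner ℂ ((exists_hilbertBasis ℂ (L2 d)).choose_spec.choose k)
    (A ((exists_hilbertBasis ℂ (L2 d)).choose_spec.choose k))).re

/-- A density operator: a positive trace class operator of trace one. (For a positive operator,
`|S| = S`, and finiteness of the trace means that it is trace class, in particular compact.) -/
structure IsDensityOperator (S : L2 d →L[ℂ] L2 d) : Prop where
  isPositive : S.IsPositive
  trace_eq_one : posTrace S = 1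

/-! ### Counting eigenvalues -/

/-- The number of eigenvalues of `A` (a self-adjoint operator, so that they are real) exceeding
`c`, each counted with its multiplicity: the sum of the dimensions of the eigenspaces `ker (A - μ)`
over all real `μ > c`. Its value is in `[0, ∞]`. -/
def eigenvalueCount (A : L2 d →L[ℂ] L2 d) (c : ℝ) : ℝ≥0∞ :=
  ∑' μ : Set.Ioi c, ((Module.rank ℂ
    (Module.End.eigenspace (A : L2 d →ₗ[ℂ] L2 d) ((μ : ℝ) : ℂ))).toENat : ℝ≥0∞)

end QHA

end

/-!
Write `A` for the localization operator `χ_Ω ⋆ S` of a compact set `Ω`. The count of eigenvalues of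
`A` above `1 - δ` is compared with `tr A` by means of `tr A - tr A²`.

Moyal's identity `∫ |⟨π(z) ψ, φ⟩|² dz = ‖ψ‖² ‖φ‖²` (`QHA.lintegral_enorm_inner_timeFreqShift_sq`)
is Plancherel's theorem in the frequency variable followed by Tonelli's theorem. With `b k` the
images of an orthonormal basis under `√S`, one has `S = ∑ₖ ⟨b k, ·⟩ b k` and `∑ₖ ‖b k‖² = tr S = 1`,
so the Husimi function `z ↦ ⟨ψ, α_z(S) ψ⟩ = ∑ₖ |⟨π(z) b k, ψ⟩|²` has integral `‖ψ‖²`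
(`QHA.lintegral_husimi`). Since `⟨ψ, A ψ⟩` is the integral of the Husimi function over `Ω`, it
follows that `0 ≤ A ≤ 1` and `tr A = |Ω|`. In particular `A` is compact, and there is an orthonormal
basis of eigenvectors of `A`, in which the eigenvalues are counted.

In that basis `tr A - tr A² = ∑ⱼ λⱼ (1 - λⱼ)` is a sum of nonnegative terms which the covariance of
the Husimi function turns into `∫_{z ∈ Ω} ∫_{w ∉ Ω} F (w - z)`, where `F` is a probability density
on phase space depending on `S` only (`QHA.tsum_setLIntegral_husimi_mul_compl`). The indicator of
`λ > 1 - δ` differs from `λ ∈ [0, 1]` by at most `λ (1 - λ) / min δ (1 - δ)`, so the count differs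
from `|Ω|` by at most a constant multiple of this double integral
(`QHA.eigenvalueCount_locOp_le_and_le`).

For the dilates `R • Ω` the double integral equals `R ^ (2 * d)` times
`∫ F y * |{z ∈ Ω | z + y / R ∉ Ω}| dy`, and the latter tends to `0` by dominated convergence
(`IsCompact.tendsto_setLIntegral_compl_smul_div`).
-/

universe u

noncomputable section

/-! ### Plancherel's theorem and Moyal's identity -/

open FourierTransform SchwartzMap ContDiff in
/-- On `L¹ ∩ L²` the Fourier integral agrees with the `L²`-Fourier transform: both define the same
tempered distribution. -/
theorem MeasureTheory.MemLp.fourier_toLp_ae_eq {E : Type*} [NormedAddCommGroup E]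
    [InnerProductSpace ℝ E] [FiniteDimensional ℝ E] [MeasurableSpace E] [BorelSpace E]
    {f : E → ℂ} (hf : MemLp f 2 (volume : Measure E)) (hf₁ : Integrable f) :
    (𝓕 (hf.toLp f) : Lp ℂ 2 (volume : Measure E)) =ᵐ[volume] 𝓕 f := by
  have hcont : Continuous (𝓕 f) :=
    VectorFourier.fourierIntegral_continuous Real.continuous_fourierChar
      (by exact continuous_inner) hf₁
  refine ae_eq_of_integral_contDiff_smul_eq
    ((Lp.memLp _).locallyIntegrable one_le_two) hcont.locallyIntegrable fun g hg hgc => ?_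
  have hg₁ : HasCompactSupport (Complex.ofRealCLM ∘ g) := hgc.comp_left rfl
  have hg₂ : ContDiff ℝ ∞ (Complex.ofRealCLM ∘ g) := by fun_prop
  set G : 𝓢(E, ℂ) := hg₁.toSchwartzMap hg₂
  have hG : ∀ x, G x = (g x : ℂ) := fun x => rfl
  calc ∫ x, g x • (𝓕 (hf.toLp f) : Lp ℂ 2 (volume : Measure E)) x
      = Lp.toTemperedDistribution (𝓕 (hf.toLp f) : Lp ℂ 2 (volume : Measure E)) G := by
        simp [hG]
    _ = ∫ x, (𝓕 G) x • (hf.toLp f) x := by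
        rw [← Lp.fourier_toTemperedDistribution_eq, TemperedDistribution.fourier_apply,
          Lp.toTemperedDistribution_apply]
    _ = ∫ x, 𝓕 (G : E → ℂ) x • f x := by
        refine integral_congr_ae ?_
        filter_upwards [hf.coeFn_toLp] with x hx
        rw [hx, SchwartzMap.fourier_coe]
    _ = ∫ x, G x • 𝓕 f x := by
        have h := VectorFourier.integral_fourierIntegral_smul_eq_flip (L := innerₗ E)
          Real.continuous_fourierChar (by exact continuous_inner)
          (G.integrable (μ := volume)) hf₁
        rw [flip_innerₗ] at h
        exact h
    _ = ∫ x, g x • 𝓕 f x := by simp [hG]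

open FourierTransform in
/-- Plancherel's theorem for the Fourier integral of a function in `L¹ ∩ L²`. -/
theorem MeasureTheory.MemLp.lintegral_enorm_fourier_sq {E : Type*} [NormedAddCommGroup E]
    [InnerProductSpace ℝ E] [FiniteDimensional ℝ E] [MeasurableSpace E] [BorelSpace E]
    {f : E → ℂ} (hf : MemLp f 2 (volume : Measure E)) (hf₁ : Integrable f) :
    ∫⁻ x, ‖𝓕 f x‖ₑ ^ 2 = ∫⁻ x, ‖f x‖ₑ ^ 2 := by
  have h : ∀ g : E → ℂ, ∫⁻ x, ‖g x‖ₑ ^ 2 = eLpNorm g 2 volume ^ 2 := fun g => by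
    simpa using (eLpNorm_nnreal_pow_eq_lintegral (f := g) (μ := (volume : Measure E))
      (p := 2) (by norm_num)).symm
  rw [h, h, ← eLpNorm_congr_ae (hf.fourier_toLp_ae_eq hf₁), ← eLpNorm_congr_ae hf.coeFn_toLp,
    ← Lp.enorm_def, ← Lp.enorm_def, ← ofReal_norm, ← ofReal_norm, Lp.norm_fourier_eq]


namespace QHA

variable {d : ℕ}

theorem L2.enorm_sq_eq_lintegral (ψ : L2 d) : ‖ψ‖ₑ ^ 2 = ∫⁻ t, ‖ψ t‖ₑ ^ 2 := by
  rw [Lp.enorm_def]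
  simpa using eLpNorm_nnreal_pow_eq_lintegral (f := ψ) (μ := (volume : Measure (Config d)))
      (p := 2) (by norm_num)

theorem coeFn_timeFreqShift (z : Phase d) (ψ : L2 d) :
    timeFreqShift z ψ =ᵐ[volume] fun t => phaseFactor z.2 t * ψ (t - z.1) := by
  filter_upwards [coeFn_modulation z.2 (translation z.1 ψ), coeFn_translation z.1 ψ] with t h1 h2
  change modulation z.2 (translation z.1 ψ) t = _
  rw [h1, h2]

open FourierTransform in
/-- A matrix coefficient of the time-frequency shifts is, as a function of the frequency `ω`, the
Fourier transform of `t ↦ conj (ψ (t - x)) * φ t`. -/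
theorem inner_timeFreqShift_eq_fourier (z : Phase d) (ψ φ : L2 d) :
    inner ℂ (timeFreqShift z ψ) φ
      = 𝓕 (fun t => (starRingEnd ℂ) (ψ (t - z.1)) * φ t) z.2 := by
  rw [L2.inner_def, Real.fourier_eq']
  refine integral_congr_ae ?_
  filter_upwards [coeFn_timeFreqShift z ψ] with t ht
  rw [ht, RCLike.inner_apply, map_mul, phaseFactor, ← Complex.exp_conj, smul_eq_mul]
  have : (starRingEnd ℂ) (2 * Real.pi * Complex.I * (inner ℝ z.2 t : ℝ))
      = ((-2 * Real.pi * inner ℝ t z.2 : ℝ) : ℂ) * Complex.I := by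
    rw [real_inner_comm]
    simp [Complex.conj_ofNat]
    ring
  rw [this]
  push_cast
  ring

/-- The orthogonality relation for time-frequency shifts (Moyal's identity). -/
theorem lintegral_enorm_inner_timeFreqShift_sq (ψ φ : L2 d) :
    ∫⁻ z : Phase d, ‖inner ℂ (timeFreqShift z ψ) φ‖ₑ ^ 2 = ‖ψ‖ₑ ^ 2 * ‖φ‖ₑ ^ 2 := by
  have hmeas : Measurable fun p : Config d × Config d => ‖ψ (p.2 - p.1)‖ₑ ^ 2 * ‖φ p.2‖ₑ ^ 2 := by
    have h1 := (Lp.stronglyMeasurable ψ).measurable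
    have h2 := (Lp.stronglyMeasurable φ).measurable
    fun_prop
  have htotal : ∫⁻ x, ∫⁻ t, ‖ψ (t - x)‖ₑ ^ 2 * ‖φ t‖ₑ ^ 2 = ‖ψ‖ₑ ^ 2 * ‖φ‖ₑ ^ 2 := by
    rw [lintegral_lintegral_swap hmeas.aemeasurable]
    have h1 := (Lp.stronglyMeasurable ψ).measurable
    have h2 := (Lp.stronglyMeasurable φ).measurable
    have : ∀ t, ∫⁻ x, ‖ψ (t - x)‖ₑ ^ 2 * ‖φ t‖ₑ ^ 2 = ‖ψ‖ₑ ^ 2 * ‖φ t‖ₑ ^ 2 := fun t => by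
      rw [lintegral_mul_const _ (by fun_prop),
        lintegral_sub_left_eq_self (fun t => ‖ψ t‖ₑ ^ 2) t, L2.enorm_sq_eq_lintegral]
    simp_rw [this]
    rw [lintegral_const_mul _ (by fun_prop), ← L2.enorm_sq_eq_lintegral]
  rw [Measure.volume_eq_prod, lintegral_prod _ (Continuous.aemeasurable (by
    have := continuous_timeFreqShift ψ
    fun_prop)), ← htotal]
  -- For almost every `x` the product `conj (ψ (t - x)) * φ t` is square integrable.
  have hfin : ∀ᵐ x : Config d, ∫⁻ t, ‖ψ (t - x)‖ₑ ^ 2 * ‖φ t‖ₑ ^ 2 < ∞ := by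
    refine ae_lt_top hmeas.lintegral_prod_right' ?_
    rw [htotal]
    finiteness
  refine lintegral_congr_ae ?_
  filter_upwards [hfin] with x hx
  have hψ : MemLp (fun t => (starRingEnd ℂ) (ψ (t - x))) 2 (volume : Measure (Config d)) :=
    ((Lp.memLp ψ).comp_measurePreserving (measurePreserving_sub_right volume x)).star
  have hint : Integrable fun t => (starRingEnd ℂ) (ψ (t - x)) * φ t :=
    hψ.integrable_mul (Lp.memLp φ)
  have hnorm : ∀ t, ‖(starRingEnd ℂ) (ψ (t - x)) * φ t‖ₑ ^ 2 = ‖ψ (t - x)‖ₑ ^ 2 * ‖φ t‖ₑ ^ 2 :=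
    fun t => by
      rw [enorm_mul, mul_pow]
      simp [← ofReal_norm]
  have hL2 : MemLp (fun t => (starRingEnd ℂ) (ψ (t - x)) * φ t) 2
      (volume : Measure (Config d)) := by
    refine ⟨hint.aestronglyMeasurable, ?_⟩
    rw [eLpNorm_lt_top_iff_lintegral_rpow_enorm_lt_top (by norm_num) (by norm_num)]
    simpa only [ENNReal.toReal_ofNat, ENNReal.rpow_ofNat, hnorm] using hx
  simp_rw [inner_timeFreqShift_eq_fourier]
  rw [hL2.lintegral_enorm_fourier_sq hint]
  exact lintegral_congr hnorm

end QHA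

/-! ### Hilbert bases, compact operators and positive operators -/

section HilbertSpace

variable {H ι : Type*} [NormedAddCommGroup H] [InnerProductSpace ℂ H]

theorem Orthonormal.countable_of_separableSpace [TopologicalSpace.SeparableSpace H] {v : ι → H}
    (hv : Orthonormal ℂ v) : Countable ι := by
  refine Pairwise.countable_of_isOpen_disjoint (s := fun i => Metric.ball (v i) (1 / 2)) ?_
    (fun i => Metric.isOpen_ball) fun i => ⟨v i, Metric.mem_ball_self (by norm_num)⟩
  intro i j hij
  refine Metric.ball_disjoint_ball ?_
  rw [dist_eq_norm]
  have h : ‖v i - v j‖ ^ 2 = 2 := by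
    rw [@norm_sub_sq ℂ, hv.2 hij, hv.1, hv.1]
    norm_num
  nlinarith [norm_nonneg (v i - v j)]

/-- Parseval's identity. -/
theorem HilbertBasis.tsum_enorm_inner_sq (b : HilbertBasis ι ℂ H) (x : H) :
    ∑' i, ‖inner ℂ (b i) x‖ₑ ^ 2 = ‖x‖ₑ ^ 2 := by
  have h := (b.hasSum_inner_mul_inner x x).mapL Complex.reCLM
  have hterm : ∀ i, Complex.reCLM (inner ℂ x (b i) * inner ℂ (b i) x) = ‖inner ℂ (b i) x‖ ^ 2 := by
    intro i
    rw [← inner_conj_symm x (b i), RCLike.conj_mul]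
    norm_cast
  simp_rw [hterm] at h
  have hx : Complex.reCLM (inner ℂ x x) = ‖x‖ ^ 2 := by
    rw [inner_self_eq_norm_sq_to_K]
    norm_cast
  rw [hx] at h
  simp_rw [← ofReal_norm, ← ENNReal.ofReal_pow (norm_nonneg _)]
  rw [← h.tsum_eq, ENNReal.ofReal_tsum_of_nonneg (fun i => by positivity) h.summable]

theorem HilbertBasis.tsum_enorm_inner_sq' (b : HilbertBasis ι ℂ H) (x : H) :
    ∑' i, ‖inner ℂ x (b i)‖ₑ ^ 2 = ‖x‖ₑ ^ 2 := by
  rw [← b.tsum_enorm_inner_sq x]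
  refine tsum_congr fun i => ?_
  rw [← ofReal_norm, ← ofReal_norm, norm_inner_symm]

/-- The algebraic dimension and the cardinality of a Hilbert basis agree as extended naturals:
both are `⊤` as soon as one of them is infinite. -/
theorem HilbertBasis.rank_toENat_eq_card (b : HilbertBasis ι ℂ H) :
    (Module.rank ℂ H).toENat = ENat.card ι := by
  cases finite_or_infinite ι
  · have := Fintype.ofFinite ι
    have h := rank_eq_card_basis b.toOrthonormalBasis.toBasis
    simp [h]
  · have h := b.orthonormal.linearIndependent.aleph0_le_rank
    rw [ENat.card_eq_top_of_infinite, Cardinal.toENat_eq_top]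
    exact h

/-- The quadratic form of a positive operator in a Hilbert basis of eigenvectors. -/
theorem HilbertBasis.tsum_eigenvalue_mul_enorm_inner_sq (e : HilbertBasis ι ℂ H) {S : H →L[ℂ] H}
    (hS : S.IsPositive) {μ : ι → ℝ} (hμ : ∀ j, 0 ≤ μ j) (he : ∀ j, S (e j) = (μ j : ℂ) • e j)
    (ψ : H) :
    ∑' j, ENNReal.ofReal (μ j) * ‖inner ℂ (e j) ψ‖ₑ ^ 2
      = ENNReal.ofReal (inner ℂ ψ (S ψ)).re := by
  have h := (e.hasSum_inner_mul_inner ψ (S ψ)).mapL Complex.reCLM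
  have hterm : ∀ j, Complex.reCLM (inner ℂ ψ (e j) * inner ℂ (e j) (S ψ))
      = μ j * ‖inner ℂ (e j) ψ‖ ^ 2 := by
    intro j
    rw [← hS.inner_left_eq_inner_right, he, inner_smul_left, Complex.conj_ofReal, mul_left_comm,
      ← inner_conj_symm ψ (e j), RCLike.conj_mul]
    rw [Complex.reCLM_apply, Complex.re_ofReal_mul]
    norm_cast
  simp_rw [hterm] at h
  simp_rw [← ofReal_norm, ← ENNReal.ofReal_pow (norm_nonneg _)]
  simp_rw [← ENNReal.ofReal_mul (hμ _)]
  rw [← ENNReal.ofReal_tsum_of_nonneg (fun j => mul_nonneg (hμ j) (by positivity)) h.summable,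
    h.tsum_eq]
  rfl

variable [CompleteSpace H]

/-- The operator norm is at most the Hilbert–Schmidt norm. -/
theorem HilbertBasis.enorm_sq_le_tsum (b : HilbertBasis ι ℂ H) (T : H →L[ℂ] H) :
    ‖T‖ₑ ^ 2 ≤ ∑' i, ‖T (b i)‖ₑ ^ 2 := by
  by_cases hT : ∑' i, ‖T (b i)‖ₑ ^ 2 = ∞
  · rw [hT]
    exact le_top
  -- Parseval bounds the norm of the adjoint, which is that of `T`.
  have hadj : ∀ y, ‖ContinuousLinearMap.adjoint T y‖ₑ ^ 2
      ≤ (∑' i, ‖T (b i)‖ₑ ^ 2) * ‖y‖ₑ ^ 2 := fun y => by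
    rw [← b.tsum_enorm_inner_sq, ← ENNReal.tsum_mul_right]
    refine ENNReal.tsum_le_tsum fun i => ?_
    rw [ContinuousLinearMap.adjoint_inner_right, ← mul_pow]
    gcongr
    rw [← ofReal_norm, ← ofReal_norm, ← ofReal_norm, ← ENNReal.ofReal_mul (norm_nonneg _)]
    exact ENNReal.ofReal_le_ofReal (norm_inner_le_norm _ _)
  set C := ∑' i, ‖T (b i)‖ₑ ^ 2
  have hle : ‖ContinuousLinearMap.adjoint T‖ ≤ √C.toReal := by
    refine ContinuousLinearMap.opNorm_le_bound _ (Real.sqrt_nonneg _) fun y => ?_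
    refine abs_le_of_sq_le_sq' ?_ (by positivity) |>.2
    have h := ENNReal.toReal_mono (by finiteness) (hadj y)
    rw [mul_pow, Real.sq_sqrt ENNReal.toReal_nonneg]
    simpa using h
  rw [← ENNReal.toReal_le_toReal (by finiteness) hT]
  have h := pow_le_pow_left₀ (norm_nonneg _) hle 2
  rw [Real.sq_sqrt ENNReal.toReal_nonneg, LinearIsometryEquiv.norm_map] at h
  simpa using h

/-- A Hilbert–Schmidt operator is compact: it is the norm limit of its compositions with the
orthogonal projections onto the spans of finitely many basis vectors. -/
theorem HilbertBasis.isCompactOperator_of_tsum_enorm_sq_ne_top (b : HilbertBasis ι ℂ H)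
    (T : H →L[ℂ] H) (hT : ∑' i, ‖T (b i)‖ₑ ^ 2 ≠ ∞) : IsCompactOperator T := by
  classical
  let P : Finset ι → H →L[ℂ] H := fun s => ∑ i ∈ s, InnerProductSpace.rankOne ℂ (T (b i)) (b i)
  have hP : ∀ s x, P s x = ∑ i ∈ s, inner ℂ (b i) x • T (b i) := fun s x => by
    simp [P]
  have hcomp : ∀ s, IsCompactOperator (P s) := by
    intro s
    refine Finset.sum_induction (fun i => InnerProductSpace.rankOne ℂ (T (b i)) (b i))
      (fun A : H →L[ℂ] H => IsCompactOperator A) (fun A B hA hB => ?_) ?_ fun i _ => ?_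
    · exact hA.add hB
    · exact isCompactOperator_zero
    · exact (isCompactOperator_of_locallyCompactSpace_dom (innerSL ℂ (b i))).clm_comp
        (ContinuousLinearMap.toSpanSingleton ℂ (T (b i)))
  have hPb : ∀ s i, (P s - T) (b i) = if i ∈ s then 0 else -T (b i) := fun s i => by
    simp only [sub_apply, hP, orthonormal_iff_ite.1 b.orthonormal, ite_smul,
      one_smul, zero_smul, Finset.sum_ite_eq']
    split_ifs <;> simp
  have hbound : ∀ s, ‖P s - T‖ₑ ^ 2 ≤ ∑' i : {i // i ∉ s}, ‖T (b i)‖ₑ ^ 2 := by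
    intro s
    refine (b.enorm_sq_le_tsum _).trans ?_
    refine le_trans ?_ (tsum_subtype {i | i ∉ s} fun i => ‖T (b i)‖ₑ ^ 2).ge
    refine ENNReal.tsum_le_tsum fun i => ?_
    rw [hPb]
    by_cases hi : i ∈ s <;> simp [hi]
  refine isCompactOperator_of_tendsto (l := atTop) (F := P) ?_ (Eventually.of_forall hcomp)
  rw [tendsto_iff_norm_sub_tendsto_zero]
  have h := tendsto_of_tendsto_of_tendsto_of_le_of_le tendsto_const_nhds
    (ENNReal.tendsto_tsum_compl_atTop_zero hT) (fun _ => zero_le) hbound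
  have h' := ((ENNReal.tendsto_toReal ENNReal.zero_ne_top).comp h).sqrt
  simpa [Function.comp_def] using h'

/-- Spectral theorem for compact self-adjoint operators: there is a Hilbert basis of eigenvectors,
indexed by the pairs of a real number `μ` and an element of a basis of the eigenspace of `μ`. -/
theorem exists_hilbertBasis_eigenvectors {H : Type u} [NormedAddCommGroup H]
    [InnerProductSpace ℂ H] [CompleteSpace H] {T : H →L[ℂ] H} (hT : IsCompactOperator T)
    (hs : (T : H →ₗ[ℂ] H).IsSymmetric) :
    ∃ (ι : ℝ → Type u) (b : HilbertBasis (Σ μ, ι μ) ℂ H),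
      (∀ j, T (b j) = (j.1 : ℂ) • b j) ∧
      ∀ μ : ℝ, (Module.rank ℂ (Module.End.eigenspace (T : H →ₗ[ℂ] H) (μ : ℂ))).toENat
        = ENat.card (ι μ) := by
  let E : ℝ → Submodule ℂ H := fun μ => Module.End.eigenspace (T : H →ₗ[ℂ] H) (μ : ℂ)
  have hclosed : ∀ μ, IsClosed (E μ : Set H) := fun μ => by
    have : (E μ : Set H) = {x | T x = (μ : ℂ) • x} := by
      ext x
      simp [E]
    rw [this]
    exact isClosed_eq T.continuous (continuous_const_smul _)
  have hcs : ∀ μ, CompleteSpace (E μ) := fun μ => (hclosed μ).completeSpace_coe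
  choose w e he using fun μ => exists_hilbertBasis ℂ (E μ)
  let v : (Σ μ, w μ) → H := fun j => (e j.1 j.2 : H)
  have hmem : ∀ j, T (v j) = (j.1 : ℂ) • v j := fun j =>
    Module.End.mem_eigenspace_iff.1 (e j.1 j.2).2
  have hfam : OrthogonalFamily ℂ (fun μ => E μ) fun μ => (E μ).subtypeₗᵢ :=
    hs.orthogonalFamily_eigenspaces.comp Complex.ofReal_injective
  have hv : Orthonormal ℂ v := hfam.orthonormal_sigma_orthonormal fun μ => (e μ).orthonormal
  have hbot : (Submodule.span ℂ (Set.range v))ᗮ = ⊥ := by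
    rw [eq_bot_iff, ← ContinuousLinearMap.orthogonalComplement_iSup_eigenspaces_eq_bot hT hs]
    rw [← Submodule.iInf_orthogonal]
    intro x hx
    rw [Submodule.mem_iInf]
    intro μ
    rw [Submodule.mem_orthogonal]
    intro y hy
    rcases eq_or_ne y 0 with rfl | hy0
    · exact inner_zero_left _
    have hμ : ((μ.re : ℝ) : ℂ) = μ := Complex.conj_eq_iff_re.1 <| hs.conj_eigenvalue_eq_self <|
      Module.End.hasEigenvalue_of_hasEigenvector ⟨hy, hy0⟩
    rw [← hμ] at hy
    have hsum := ((e μ.re).hasSum_repr ⟨y, hy⟩).mapL (innerSL ℂ x ∘L (E μ.re).subtypeL)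
    have hzero : ∀ i, (innerSL ℂ x ∘L (E μ.re).subtypeL)
        ((e μ.re).repr ⟨y, hy⟩ i • (e μ.re i : E μ.re)) = 0 := fun i => by
      have : inner ℂ x (v ⟨μ.re, i⟩) = 0 :=
        (Submodule.mem_orthogonal' _ _).1 hx _ (Submodule.subset_span ⟨_, rfl⟩)
      rw [map_smul]
      exact (congrArg _ this).trans (smul_zero _)
    simp_rw [hzero] at hsum
    exact inner_eq_zero_symm.1 (hsum.unique hasSum_zero)
  refine ⟨fun μ => w μ, HilbertBasis.mkOfOrthogonalEqBot hv hbot, fun j => ?_, fun μ => ?_⟩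
  · rw [HilbertBasis.coe_mkOfOrthogonalEqBot]
    exact hmem j
  · exact (e μ).rank_toENat_eq_card

theorem ContinuousLinearMap.inner_sqrt_left {S : H →L[ℂ] H} (x y : H) :
    inner ℂ (CFC.sqrt S x) y = inner ℂ x (CFC.sqrt S y) :=
  ((ContinuousLinearMap.nonneg_iff_isPositive _).1 (CFC.sqrt_nonneg S)).inner_left_eq_inner_right
    x y

theorem ContinuousLinearMap.IsPositive.ofReal_re_inner_self {S : H →L[ℂ] H} (hS : S.IsPositive)
    (ψ : H) : ENNReal.ofReal (inner ℂ ψ (S ψ)).re = ‖CFC.sqrt S ψ‖ₑ ^ 2 := by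
  have hsq : CFC.sqrt S * CFC.sqrt S = S :=
    CFC.sqrt_mul_sqrt_self S ((ContinuousLinearMap.nonneg_iff_isPositive S).2 hS)
  have : inner ℂ ψ (S ψ) = inner ℂ (CFC.sqrt S ψ) (CFC.sqrt S ψ) := by
    rw [ContinuousLinearMap.inner_sqrt_left]
    nth_rw 1 [← hsq]
    rfl
  rw [this, inner_self_eq_norm_sq_to_K, ← ofReal_norm, ← ENNReal.ofReal_pow (norm_nonneg _)]
  norm_cast

/-- A positive operator `S` is a sum of rank one operators `⟨b k, ·⟩ b k`, where the squared norms
of the vectors `b k` sum to its trace: take the images of a Hilbert basis under `√S`. -/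
theorem HilbertBasis.exists_rankOne_decomposition (e : HilbertBasis ι ℂ H) {S : H →L[ℂ] H}
    (hS : S.IsPositive) : ∃ b : ι → H,
      (∑' k, ‖b k‖ₑ ^ 2 = ∑' k, ENNReal.ofReal (inner ℂ (e k) (S (e k))).re) ∧
      ∀ ψ, ENNReal.ofReal (inner ℂ ψ (S ψ)).re = ∑' k, ‖inner ℂ (b k) ψ‖ₑ ^ 2 := by
  refine ⟨fun k => CFC.sqrt S (e k),
    tsum_congr fun k => (hS.ofReal_re_inner_self _).symm, fun ψ => ?_⟩
  rw [hS.ofReal_re_inner_self, ← e.tsum_enorm_inner_sq]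
  simp_rw [ContinuousLinearMap.inner_sqrt_left]

/-- A positive operator of finite trace is compact, because its square root is Hilbert–Schmidt. -/
theorem HilbertBasis.isCompactOperator_of_tsum_inner_ne_top (e : HilbertBasis ι ℂ H)
    {S : H →L[ℂ] H} (hS : S.IsPositive)
    (htr : ∑' k, ENNReal.ofReal (inner ℂ (e k) (S (e k))).re ≠ ∞) : IsCompactOperator S := by
  simp_rw [hS.ofReal_re_inner_self] at htr
  have h := (e.isCompactOperator_of_tsum_enorm_sq_ne_top _ htr).comp_clm (CFC.sqrt S)
  have hsq : CFC.sqrt S * CFC.sqrt S = S :=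
    CFC.sqrt_mul_sqrt_self S ((ContinuousLinearMap.nonneg_iff_isPositive S).2 hS)
  rw [← hsq]
  exact h

end HilbertSpace

/-! ### Husimi functions and the quadratic form of a localization operator -/

namespace QHA

variable {d : ℕ}

theorem phaseFactor_add_left (ω η t : Config d) :
    phaseFactor (ω + η) t = phaseFactor ω t * phaseFactor η t := by
  rw [phaseFactor, phaseFactor, phaseFactor, ← Complex.exp_add, inner_add_left]
  push_cast
  ring_nf

theorem phaseFactor_sub_right (ω s t : Config d) :
    phaseFactor ω (s - t) = phaseFactor ω (-t) * phaseFactor ω s := by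
  rw [phaseFactor, phaseFactor, phaseFactor, ← Complex.exp_add, inner_sub_right, inner_neg_right]
  push_cast
  ring_nf

/-- The time-frequency shifts form a projective representation of phase space. -/
theorem timeFreqShift_timeFreqShift (z w : Phase d) (ψ : L2 d) :
    timeFreqShift z (timeFreqShift w ψ)
      = phaseFactor w.2 (-z.1) • timeFreqShift (z + w) ψ := by
  apply Lp.ext
  filter_upwards [coeFn_timeFreqShift z (timeFreqShift w ψ), coeFn_timeFreqShift (z + w) ψ,
    (measurePreserving_sub_right (volume : Measure (Config d)) z.1).quasiMeasurePreserving.ae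
      (coeFn_timeFreqShift w ψ),
    Lp.coeFn_smul (phaseFactor w.2 (-z.1)) (timeFreqShift (z + w) ψ)] with t h1 h2 h3 h4
  rw [h1, h3, h4, Pi.smul_apply, h2, smul_eq_mul, Prod.fst_add, Prod.snd_add,
    phaseFactor_add_left, phaseFactor_sub_right, sub_sub]
  ring

theorem inner_opShift (z : Phase d) (A : L2 d →L[ℂ] L2 d) (ψ : L2 d) :
    inner ℂ ψ (opShift z A ψ)
      = inner ℂ ((timeFreqShift z).symm ψ) (A ((timeFreqShift z).symm ψ)) := by
  rw [opShift_apply]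
  nth_rw 1 [← (timeFreqShift z).apply_symm_apply ψ]
  rw [LinearIsometryEquiv.inner_map_map]

/-- The Husimi function `z ↦ ⟨ψ, α_z(S) ψ⟩` of `ψ` on phase space with window `S`. For a positive
operator `S` its values are nonnegative reals; they are taken in `[0, ∞]` so that sums and integrals
can be exchanged freely. -/
def husimi (S : L2 d →L[ℂ] L2 d) (ψ : L2 d) (z : Phase d) : ℝ≥0∞ :=
  ENNReal.ofReal (inner ℂ ψ (opShift z S ψ)).re

theorem measurable_husimi (S : L2 d →L[ℂ] L2 d) (ψ : L2 d) : Measurable (husimi S ψ) := by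
  have := continuous_opShift S ψ
  exact ENNReal.measurable_ofReal.comp (Continuous.measurable (by fun_prop))

/-- Covariance of the Husimi function under time-frequency shifts. -/
theorem husimi_timeFreqShift (S : L2 d →L[ℂ] L2 d) (ψ : L2 d) (z w : Phase d) :
    husimi S (timeFreqShift z ψ) w = husimi S ψ (w - z) := by
  have hunit : ∀ ω t : Config d, (starRingEnd ℂ) (phaseFactor ω t) * phaseFactor ω t = 1 :=
    fun ω t => by rw [RCLike.conj_mul, norm_phaseFactor]; norm_num
  -- `π(w)* π(z) ψ` and `π(w - z)* ψ` differ by a phase, which cancels in the quadratic form.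
  set χ := (timeFreqShift (w - z)).symm ψ with hχ
  have h : timeFreqShift z ψ
      = timeFreqShift w ((phaseFactor (w - z).2 (-z.1)) • χ) := by
    rw [map_smul, ← (timeFreqShift (w - z)).apply_symm_apply ψ, ← hχ,
      timeFreqShift_timeFreqShift, add_sub_cancel]
  rw [husimi, husimi, inner_opShift, inner_opShift, h, LinearIsometryEquiv.symm_apply_apply,
    map_smul, inner_smul_left, inner_smul_right, ← mul_assoc, hunit, one_mul]

section Decomposition

variable {S : L2 d →L[ℂ] L2 d} {ι : Type*} {b : ι → L2 d}

theorem husimi_eq_tsum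
    (hS : ∀ ψ, ENNReal.ofReal (inner ℂ ψ (S ψ)).re = ∑' k, ‖inner ℂ (b k) ψ‖ₑ ^ 2)
    (ψ : L2 d) (z : Phase d) :
    husimi S ψ z = ∑' k, ‖inner ℂ (timeFreqShift z (b k)) ψ‖ₑ ^ 2 := by
  rw [husimi, inner_opShift, hS]
  refine tsum_congr fun k => ?_
  rw [← LinearIsometryEquiv.inner_map_map (timeFreqShift z) (b k),
    LinearIsometryEquiv.apply_symm_apply]

theorem measurable_enorm_inner_timeFreqShift_sq (ψ φ : L2 d) :
    Measurable fun z : Phase d => ‖inner ℂ (timeFreqShift z ψ) φ‖ₑ ^ 2 := by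
  have := continuous_timeFreqShift ψ
  exact Continuous.measurable (by fun_prop)

/-- Each translate of `S` has trace one, in any Hilbert basis. -/
theorem tsum_husimi_hilbertBasis {κ : Type*}
    (hS : ∀ ψ, ENNReal.ofReal (inner ℂ ψ (S ψ)).re = ∑' k, ‖inner ℂ (b k) ψ‖ₑ ^ 2)
    (hb : ∑' k, ‖b k‖ₑ ^ 2 = 1) (e : HilbertBasis κ ℂ (L2 d)) (z : Phase d) :
    ∑' j, husimi S (e j) z = 1 := by
  simp_rw [husimi_eq_tsum hS]
  rw [ENNReal.tsum_comm]
  simp_rw [e.tsum_enorm_inner_sq']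
  simpa [← ofReal_norm] using hb

variable [Countable ι]

/-- Moyal's identity for a mixed state: the translates of `S` resolve the identity. -/
theorem lintegral_husimi
    (hS : ∀ ψ, ENNReal.ofReal (inner ℂ ψ (S ψ)).re = ∑' k, ‖inner ℂ (b k) ψ‖ₑ ^ 2)
    (hb : ∑' k, ‖b k‖ₑ ^ 2 = 1) (ψ : L2 d) : ∫⁻ z, husimi S ψ z = ‖ψ‖ₑ ^ 2 := by
  simp_rw [husimi_eq_tsum hS]
  rw [lintegral_tsum fun k => (measurable_enorm_inner_timeFreqShift_sq _ _).aemeasurable]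
  simp_rw [lintegral_enorm_inner_timeFreqShift_sq]
  rw [ENNReal.tsum_mul_right, hb, one_mul]

end Decomposition

open ComplexOrder in
/-- The quadratic form of a localization operator is the integral of the Husimi function. -/
theorem inner_locOp_self {S : L2 d →L[ℂ] L2 d} (hS : S.IsPositive) {Ω : Set (Phase d)}
    (hΩ : IsCompact Ω) (ψ : L2 d) :
    inner ℂ ψ (locOp Ω hΩ S ψ) = ((∫⁻ z in Ω, husimi S ψ z).toReal : ℂ) := by
  have hnn : ∀ z, 0 ≤ (inner ℂ ψ (opShift z S ψ) : ℂ) := fun z => by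
    rw [inner_opShift]
    exact hS.inner_nonneg_right _
  have hre : ∀ z, inner ℂ ψ (opShift z S ψ) = ((husimi S ψ z).toReal : ℂ) := fun z => by
    rw [husimi, ENNReal.toReal_ofReal (Complex.nonneg_iff.1 (hnn z)).1]
    exact (Complex.eq_re_of_ofReal_le (hnn z))
  have hind : ∀ z, Ω.indicator (1 : Phase d → ℂ) z * inner ℂ ψ (opShift z S ψ)
      = Ω.indicator (fun z => ((husimi S ψ z).toReal : ℂ)) z := fun z => by
    by_cases hz : z ∈ Ω <;> simp [hz, hre]
  rw [locOp, inner_fnOpConv]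
  simp_rw [hind]
  rw [integral_indicator hΩ.measurableSet, integral_complex_ofReal,
    integral_toReal (measurable_husimi S ψ).aemeasurable]
  exact Eventually.of_forall fun z => ENNReal.ofReal_lt_top

theorem isPositive_locOp {S : L2 d →L[ℂ] L2 d} (hS : S.IsPositive) {Ω : Set (Phase d)}
    (hΩ : IsCompact Ω) : (locOp Ω hΩ S).IsPositive := by
  rw [ContinuousLinearMap.isPositive_iff_complex]
  intro ψ
  rw [← inner_conj_symm, inner_locOp_self hS, Complex.conj_ofReal]
  exact ⟨by simp, by simp⟩

end QHA

/-! ### The traces of a localization operator and its eigenvalue count -/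

namespace QHA

variable {d : ℕ}

/-- If `e` is a Hilbert basis of eigenvectors of `A`, grouped by eigenvalue, then the number of
eigenvalues exceeding `c` is the number of members of `e` with eigenvalue exceeding `c`. -/
theorem eigenvalueCount_eq_tsum {A : L2 d →L[ℂ] L2 d} {κ : ℝ → Type*}
    (hrank : ∀ μ : ℝ, (Module.rank ℂ (Module.End.eigenspace (A : L2 d →ₗ[ℂ] L2 d) (μ : ℂ))).toENat
      = ENat.card (κ μ)) (c : ℝ) :
    eigenvalueCount A c = ∑' j : Σ μ, κ μ, if c < j.1 then 1 else 0 := by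
  rw [eigenvalueCount, ENNReal.tsum_sigma']
  simp_rw [hrank]
  rw [tsum_subtype (Set.Ioi c) fun μ => ((ENat.card (κ μ) : ℕ∞) : ℝ≥0∞)]
  refine tsum_congr fun μ => ?_
  by_cases hμ : c < μ <;> simp [hμ]

instance separableSpace_L2 : TopologicalSpace.SeparableSpace (L2 d) := by
  have : Fact ((2 : ℝ≥0∞) ≠ ∞) := ⟨ENNReal.ofNat_ne_top⟩
  infer_instance

section Trace

variable {S : L2 d →L[ℂ] L2 d} {ι : Type*} {b : ι → L2 d} {Ω : Set (Phase d)}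

/-- The trace of the localization operator of `Ω` is the measure of `Ω`. -/
theorem tsum_setLIntegral_husimi {κ : Type*}
    (hS : ∀ ψ, ENNReal.ofReal (inner ℂ ψ (S ψ)).re = ∑' k, ‖inner ℂ (b k) ψ‖ₑ ^ 2)
    (hb : ∑' k, ‖b k‖ₑ ^ 2 = 1) (e : HilbertBasis κ ℂ (L2 d)) (Ω : Set (Phase d)) :
    ∑' j, ∫⁻ z in Ω, husimi S (e j) z = volume Ω := by
  have := e.orthonormal.countable_of_separableSpace
  rw [← lintegral_tsum fun j => (measurable_husimi S (e j)).aemeasurable]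
  simp_rw [tsum_husimi_hilbertBasis hS hb]
  rw [setLIntegral_one]

variable [Countable ι]

theorem setLIntegral_husimi_add_compl
    (hS : ∀ ψ, ENNReal.ofReal (inner ℂ ψ (S ψ)).re = ∑' k, ‖inner ℂ (b k) ψ‖ₑ ^ 2)
    (hb : ∑' k, ‖b k‖ₑ ^ 2 = 1) (hΩ : MeasurableSet Ω) (ψ : L2 d) :
    (∫⁻ z in Ω, husimi S ψ z) + ∫⁻ z in Ωᶜ, husimi S ψ z = ‖ψ‖ₑ ^ 2 := by
  rw [lintegral_add_compl _ hΩ, lintegral_husimi hS hb]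

theorem setLIntegral_husimi_ne_top
    (hS : ∀ ψ, ENNReal.ofReal (inner ℂ ψ (S ψ)).re = ∑' k, ‖inner ℂ (b k) ψ‖ₑ ^ 2)
    (hb : ∑' k, ‖b k‖ₑ ^ 2 = 1) (Ω : Set (Phase d)) (ψ : L2 d) :
    ∫⁻ z in Ω, husimi S ψ z ≠ ∞ := by
  refine ne_top_of_le_ne_top ?_ (setLIntegral_le_lintegral Ω _)
  rw [lintegral_husimi hS hb]
  finiteness

theorem ofReal_re_inner_locOp
    (hpos : S.IsPositive)
    (hS : ∀ ψ, ENNReal.ofReal (inner ℂ ψ (S ψ)).re = ∑' k, ‖inner ℂ (b k) ψ‖ₑ ^ 2)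
    (hb : ∑' k, ‖b k‖ₑ ^ 2 = 1) (hΩ : IsCompact Ω) (ψ : L2 d) :
    ENNReal.ofReal (inner ℂ ψ (locOp Ω hΩ S ψ)).re = ∫⁻ z in Ω, husimi S ψ z := by
  rw [inner_locOp_self hpos, Complex.ofReal_re,
    ENNReal.ofReal_toReal (setLIntegral_husimi_ne_top hS hb Ω ψ)]

theorem isCompactOperator_locOp (hpos : S.IsPositive)
    (hS : ∀ ψ, ENNReal.ofReal (inner ℂ ψ (S ψ)).re = ∑' k, ‖inner ℂ (b k) ψ‖ₑ ^ 2)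
    (hb : ∑' k, ‖b k‖ₑ ^ 2 = 1) (hΩ : IsCompact Ω) : IsCompactOperator (locOp Ω hΩ S) := by
  obtain ⟨w, e, -⟩ := exists_hilbertBasis ℂ (L2 d)
  refine e.isCompactOperator_of_tsum_inner_ne_top (isPositive_locOp hpos hΩ) ?_
  simp_rw [ofReal_re_inner_locOp hpos hS hb]
  rw [tsum_setLIntegral_husimi hS hb]
  exact hΩ.measure_lt_top.ne

/-- The trace of `A (1 - A)` for the localization operator `A` of `Ω`, computed in a Hilbert basis
of eigenvectors. It measures how much the correlation function `∑ₖ husimi S (b k)` of `S` with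
itself leaks out of `Ω`. -/
theorem tsum_setLIntegral_husimi_mul_compl {κ : Type*} (hpos : S.IsPositive)
    (hS : ∀ ψ, ENNReal.ofReal (inner ℂ ψ (S ψ)).re = ∑' k, ‖inner ℂ (b k) ψ‖ₑ ^ 2)
    (hb : ∑' k, ‖b k‖ₑ ^ 2 = 1) (hΩ : IsCompact Ω) (e : HilbertBasis κ ℂ (L2 d)) {μ : κ → ℝ}
    (he : ∀ j, locOp Ω hΩ S (e j) = (μ j : ℂ) • e j) :
    ∑' j, (∫⁻ z in Ω, husimi S (e j) z) * ∫⁻ z in Ωᶜ, husimi S (e j) z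
      = ∫⁻ z in Ω, ∫⁻ w in Ωᶜ, ∑' k, husimi S (b k) (w - z) := by
  have hcount := e.orthonormal.countable_of_separableSpace
  have hμ : ∀ j, inner ℂ (e j) (locOp Ω hΩ S (e j)) = μ j := fun j => by
    rw [he, inner_smul_right, inner_self_eq_norm_sq_to_K, e.orthonormal.1]
    simp
  have hμ' : ∀ j, ENNReal.ofReal (μ j) = ∫⁻ z in Ω, husimi S (e j) z := fun j => by
    rw [← ofReal_re_inner_locOp hpos hS hb hΩ, hμ, Complex.ofReal_re]
  have hμ0 : ∀ j, 0 ≤ μ j := fun j => by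
    have h := (isPositive_locOp hpos hΩ).re_inner_nonneg_right (e j)
    rw [hμ] at h
    simpa using h
  -- The quadratic form of `1 - A` in the basis of eigenvectors.
  have hcompl : ∀ v, ∑' j, (∫⁻ z in Ωᶜ, husimi S (e j) z) * ‖inner ℂ (e j) v‖ₑ ^ 2
      = ∫⁻ z in Ωᶜ, husimi S v z := fun v => by
    have h1 : ∑' j, (∫⁻ z in Ω, husimi S (e j) z) * ‖inner ℂ (e j) v‖ₑ ^ 2
        = ∫⁻ z in Ω, husimi S v z := by
      simp_rw [← hμ']
      rw [e.tsum_eigenvalue_mul_enorm_inner_sq (isPositive_locOp hpos hΩ) hμ0 he,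
        ofReal_re_inner_locOp hpos hS hb]
    refine (ENNReal.add_right_inj (setLIntegral_husimi_ne_top hS hb Ω v)).1 ?_
    rw [setLIntegral_husimi_add_compl hS hb hΩ.measurableSet, ← h1, ← ENNReal.tsum_add,
      ← e.tsum_enorm_inner_sq v]
    refine tsum_congr fun j => ?_
    rw [← add_mul, setLIntegral_husimi_add_compl hS hb hΩ.measurableSet, ← ofReal_norm (e j),
      e.orthonormal.1]
    simp
  calc ∑' j, (∫⁻ z in Ω, husimi S (e j) z) * ∫⁻ z in Ωᶜ, husimi S (e j) z
      = ∫⁻ z in Ω, ∑' j, husimi S (e j) z * ∫⁻ z in Ωᶜ, husimi S (e j) z := by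
        rw [lintegral_tsum fun j => ((measurable_husimi S (e j)).mul_const _).aemeasurable]
        exact tsum_congr fun j => (lintegral_mul_const _ (measurable_husimi S (e j))).symm
    _ = ∫⁻ z in Ω, ∫⁻ w in Ωᶜ, ∑' k, husimi S (b k) (w - z) := by
        refine lintegral_congr fun z => ?_
        have hmeas : ∀ k, Measurable fun w => husimi S (b k) (w - z) := fun k =>
          (measurable_husimi S (b k)).comp (measurable_id.sub_const z)
        rw [lintegral_tsum fun k => (hmeas k).aemeasurable]
        have hk : ∀ k, ∫⁻ w in Ωᶜ, husimi S (b k) (w - z) = ∑' j,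
            (∫⁻ w in Ωᶜ, husimi S (e j) w) * ‖inner ℂ (e j) (timeFreqShift z (b k))‖ₑ ^ 2 :=
          fun k => by simp_rw [hcompl, husimi_timeFreqShift]
        simp_rw [hk, fun j => husimi_eq_tsum hS (e j) z, ← ENNReal.tsum_mul_right]
        rw [ENNReal.tsum_comm]
        refine tsum_congr fun k => tsum_congr fun j => ?_
        rw [mul_comm, ← ofReal_norm, ← ofReal_norm, norm_inner_symm]

/-- The indicator of `p > 1 - δ` differs from `p` by at most a multiple of `p (1 - p)`. -/
theorem ite_le_add_mul_and_le_ite_add_mul {δ p : ℝ} (hδ : δ ∈ Set.Ioo (0 : ℝ) 1)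
    (hp : p ∈ Set.Icc (0 : ℝ) 1) :
    (if 1 - δ < p then 1 else 0) ≤ p + (min δ (1 - δ))⁻¹ * (p * (1 - p)) ∧
      p ≤ (if 1 - δ < p then 1 else 0) + (min δ (1 - δ))⁻¹ * (p * (1 - p)) := by
  have hm : 0 < min δ (1 - δ) := lt_min hδ.1 (by linarith [hδ.2])
  have h0 : 0 ≤ p * (1 - p) := mul_nonneg hp.1 (by linarith [hp.2])
  have h1 : 0 ≤ (min δ (1 - δ))⁻¹ * (p * (1 - p)) := by positivity
  split_ifs with h
  · refine ⟨?_, by linarith [hp.2]⟩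
    have : 1 - p ≤ (min δ (1 - δ))⁻¹ * (p * (1 - p)) := by
      rw [le_inv_mul_iff₀ hm]
      exact mul_le_mul_of_nonneg_right ((min_le_right _ _).trans h.le) (by linarith [hp.2])
    linarith
  · refine ⟨by linarith [hp.1], ?_⟩
    have : p ≤ (min δ (1 - δ))⁻¹ * (p * (1 - p)) := by
      rw [le_inv_mul_iff₀ hm, mul_comm]
      exact mul_le_mul_of_nonneg_left ((min_le_left _ _).trans (by linarith)) hp.1
    linarith

/-- The number of eigenvalues of the localization operator of `Ω` exceeding `1 - δ` differs from
the measure of `Ω` by at most a constant times the trace of `A (1 - A)`. -/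
theorem eigenvalueCount_locOp_le_and_le (hpos : S.IsPositive)
    (hS : ∀ ψ, ENNReal.ofReal (inner ℂ ψ (S ψ)).re = ∑' k, ‖inner ℂ (b k) ψ‖ₑ ^ 2)
    (hb : ∑' k, ‖b k‖ₑ ^ 2 = 1) (hΩ : IsCompact Ω) {δ : ℝ} (hδ : δ ∈ Set.Ioo (0 : ℝ) 1) :
    eigenvalueCount (locOp Ω hΩ S) (1 - δ) ≤ volume Ω + ENNReal.ofReal (min δ (1 - δ))⁻¹ *
        ∫⁻ z in Ω, ∫⁻ w in Ωᶜ, ∑' k, husimi S (b k) (w - z) ∧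
      volume Ω ≤ eigenvalueCount (locOp Ω hΩ S) (1 - δ) + ENNReal.ofReal (min δ (1 - δ))⁻¹ *
        ∫⁻ z in Ω, ∫⁻ w in Ωᶜ, ∑' k, husimi S (b k) (w - z) := by
  obtain ⟨κ, e, he, hrank⟩ := exists_hilbertBasis_eigenvectors
    (isCompactOperator_locOp hpos hS hb hΩ) (isPositive_locOp hpos hΩ).isSymmetric
  have hm : 0 ≤ (min δ (1 - δ))⁻¹ := inv_nonneg.2 (le_min hδ.1.le (by linarith [hδ.2]))
  set p : (Σ μ, κ μ) → ℝ≥0∞ := fun j => ∫⁻ z in Ω, husimi S (e j) z with hp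
  set q : (Σ μ, κ μ) → ℝ≥0∞ := fun j => ∫⁻ z in Ωᶜ, husimi S (e j) z with hq
  have hpq : ∀ j, p j + q j = 1 := fun j => by
    simp only [hp, hq]
    rw [setLIntegral_husimi_add_compl hS hb hΩ.measurableSet, ← ofReal_norm,
      e.orthonormal.1]
    simp
  have hpj : ∀ j, p j = ENNReal.ofReal j.1 := fun j => by
    simp only [hp]
    rw [← ofReal_re_inner_locOp hpos hS hb hΩ, he, inner_smul_right,
      inner_self_eq_norm_sq_to_K, e.orthonormal.1]
    simp
  have hj0 : ∀ j : Σ μ, κ μ, 0 ≤ j.1 := fun j => by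
    have h := (isPositive_locOp hpos hΩ).re_inner_nonneg_right (e j)
    rw [he, inner_smul_right, inner_self_eq_norm_sq_to_K, e.orthonormal.1] at h
    simpa using h
  have hj1 : ∀ j : Σ μ, κ μ, j.1 ≤ 1 := fun j => by
    rw [← ENNReal.ofReal_le_one, ← hpj, ← hpq j]
    exact le_self_add
  have hqj : ∀ j, q j = ENNReal.ofReal (1 - j.1) := fun j => by
    rw [ENNReal.ofReal_sub _ (hj0 j), ENNReal.ofReal_one, ← hpj, ← hpq j,
      ENNReal.add_sub_cancel_left (by rw [hpj]; exact ENNReal.ofReal_ne_top)]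
  have hite : ∀ j : Σ μ, κ μ, (if 1 - δ < j.1 then 1 else 0 : ℝ≥0∞)
      = ENNReal.ofReal (if 1 - δ < j.1 then 1 else 0) := fun j => by
    split_ifs <;> simp
  rw [eigenvalueCount_eq_tsum hrank, ← tsum_setLIntegral_husimi hS hb e Ω,
    ← tsum_setLIntegral_husimi_mul_compl hpos hS hb hΩ e he, ← ENNReal.tsum_mul_left,
    ← ENNReal.tsum_add, ← ENNReal.tsum_add]
  constructor <;> refine ENNReal.tsum_le_tsum fun j => ?_
  all_goals
    change _ ≤ _ + _ * (p j * q j)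
    have h := ite_le_add_mul_and_le_ite_add_mul hδ ⟨hj0 j, hj1 j⟩
    have h1 : 0 ≤ j.1 * (1 - j.1) := mul_nonneg (hj0 j) (by linarith [hj1 j])
    rw [hite, hqj, hpj, ← ENNReal.ofReal_mul (hj0 j), ← ENNReal.ofReal_mul hm]
  · change _ ≤ p j + _
    rw [hpj, ← ENNReal.ofReal_add (hj0 j) (mul_nonneg hm h1)]
    exact ENNReal.ofReal_le_ofReal h.1
  · change p j ≤ _
    rw [hpj, ← ENNReal.ofReal_add (by split_ifs <;> norm_num) (mul_nonneg hm h1)]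
    exact ENNReal.ofReal_le_ofReal h.2

end Trace

end QHA

/-! ### Dilates of a compact set -/

section Leakage

variable {E : Type*} [NormedAddCommGroup E] [MeasurableSpace E] [BorelSpace E]

/-- Substituting `w = y + z` and exchanging the integrals expresses the leakage out of `Ω` through
the part of `Ω` that each translation moves outside. -/
theorem setLIntegral_setLIntegral_compl_sub [SecondCountableTopology E] (μ : Measure E) [SFinite μ]
    [μ.IsAddRightInvariant] {F : E → ℝ≥0∞} (hF : Measurable F) {Ω : Set E}
    (hΩ : MeasurableSet Ω) :
    ∫⁻ z in Ω, ∫⁻ w in Ωᶜ, F (w - z) ∂μ ∂μ = ∫⁻ y, F y * μ (Ω ∩ {z | y + z ∉ Ω}) ∂μ := by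
  have hset : MeasurableSet {p : E × E | p.1 ∈ Ω ∧ p.2 + p.1 ∉ Ω} :=
    (measurable_fst hΩ).inter ((measurable_snd.add measurable_fst) hΩ.compl)
  have hinner : ∀ z, Ω.indicator (fun z => ∫⁻ w in Ωᶜ, F (w - z) ∂μ) z
      = ∫⁻ y, {p : E × E | p.1 ∈ Ω ∧ p.2 + p.1 ∉ Ω}.indicator (fun p => F p.2) (z, y) ∂μ := by
    intro z
    by_cases hz : z ∈ Ω
    · rw [Set.indicator_of_mem hz, ← lintegral_indicator hΩ.compl,
        ← lintegral_add_right_eq_self _ z]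
      refine lintegral_congr fun y => ?_
      by_cases hy : y + z ∈ Ω <;> simp [hz, hy]
    · simp [hz]
  rw [← lintegral_indicator hΩ]
  simp_rw [hinner]
  have hmeas : Measurable (Function.uncurry fun z y =>
      {p : E × E | p.1 ∈ Ω ∧ p.2 + p.1 ∉ Ω}.indicator (fun p => F p.2) (z, y)) :=
    (hF.comp measurable_snd).indicator hset
  rw [lintegral_lintegral_swap hmeas.aemeasurable]
  refine lintegral_congr fun y => ?_
  have hy : MeasurableSet (Ω ∩ {z | y + z ∉ Ω}) :=
    hΩ.inter ((measurable_const.add measurable_id) hΩ.compl)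
  rw [← lintegral_indicator_const hy]
  refine lintegral_congr fun z => ?_
  by_cases hz : z ∈ Ω <;> by_cases hyz : y + z ∈ Ω <;> simp [hz, hyz]

/-- A small translation moves only a small part of a compact set outside of it. -/
theorem IsCompact.tendsto_measure_inter_add_notMem [ProperSpace E] (μ : Measure E)
    [IsFiniteMeasureOnCompacts μ] [μ.IsAddLeftInvariant] {Ω : Set E} (hΩ : IsCompact Ω) :
    Tendsto (fun y => μ (Ω ∩ {z | y + z ∉ Ω})) (𝓝 0) (𝓝 0) := by
  have hfin : μ Ω ≠ ∞ := hΩ.measure_lt_top.ne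
  have hthick : Tendsto (fun r => μ (Metric.cthickening r Ω \ Ω)) (𝓝 0) (𝓝 0) := by
    have h1 := tendsto_measure_cthickening_of_isCompact (μ := μ) hΩ
    have h2 := ENNReal.Tendsto.sub h1 (tendsto_const_nhds (x := μ Ω)) (Or.inl hfin)
    rw [tsub_self] at h2
    refine h2.congr fun r => ?_
    rw [measure_sdiff (Metric.self_subset_cthickening Ω) hΩ.measurableSet.nullMeasurableSet hfin]
  have hnorm : Tendsto (fun y : E => ‖y‖) (𝓝 0) (𝓝 0) := by
    simpa using (continuous_norm (E := E)).tendsto 0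
  refine tendsto_of_tendsto_of_tendsto_of_le_of_le tendsto_const_nhds (hthick.comp hnorm)
    (fun _ => zero_le) fun y => ?_
  calc μ (Ω ∩ {z | y + z ∉ Ω})
      ≤ μ ((fun z => y + z) ⁻¹' (Metric.cthickening ‖y‖ Ω \ Ω)) := by
        refine measure_mono fun z hz => ⟨?_, hz.2⟩
        exact Metric.mem_cthickening_of_dist_le _ z _ _ hz.1 (by simp [dist_eq_norm])
    _ = μ (Metric.cthickening ‖y‖ Ω \ Ω) := measure_preimage_add μ y _

variable [NormedSpace ℝ E] [FiniteDimensional ℝ E]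

/-- For an integrable `F ≥ 0`, the mass that convolution by `F` carries out of the dilate `R • Ω` of
a compact set is of lower order than `R ^ dim E`. -/
theorem IsCompact.tendsto_setLIntegral_compl_smul_div (μ : Measure E) [μ.IsAddHaarMeasure]
    {F : E → ℝ≥0∞} (hF : Measurable F) (hF₁ : ∫⁻ y, F y ∂μ ≠ ∞) {Ω : Set E} (hΩ : IsCompact Ω) :
    Tendsto (fun R : ℝ => (∫⁻ z in R • Ω, ∫⁻ w in (R • Ω)ᶜ, F (w - z) ∂μ ∂μ)
      / ENNReal.ofReal (R ^ Module.finrank ℝ E)) atTop (𝓝 0) := by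
  have hscale : ∀ R : ℝ, 0 < R → ∀ y, μ (R • Ω ∩ {z | y + z ∉ R • Ω})
      = ENNReal.ofReal (R ^ Module.finrank ℝ E) * μ (Ω ∩ {z | R⁻¹ • y + z ∉ Ω}) := by
    intro R hR y
    rw [← abs_of_pos (pow_pos hR (Module.finrank ℝ E)), ← Measure.addHaar_smul]
    congr 1
    ext z
    simp only [Set.mem_inter_iff, Set.mem_smul_set_iff_inv_smul_mem₀ hR.ne', Set.mem_ofPred_eq,
      smul_add]
  have hlim : Tendsto (fun R : ℝ => ∫⁻ y, F y * μ (Ω ∩ {z | R⁻¹ • y + z ∉ Ω}) ∂μ) atTop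
      (𝓝 (∫⁻ _, 0 ∂μ)) := by
    refine tendsto_lintegral_filter_of_dominated_convergence' (fun y => F y * μ Ω) ?_ ?_ ?_ ?_
    · refine Eventually.of_forall fun R => (hF.mul ?_).aemeasurable
      have hset : MeasurableSet {p : E × E | p.2 ∈ Ω ∧ R⁻¹ • p.1 + p.2 ∉ Ω} :=
        (measurable_snd hΩ.measurableSet).inter
          (((measurable_fst.const_smul R⁻¹).add measurable_snd) hΩ.measurableSet.compl)
      exact measurable_measure_prodMk_left hset
    · refine Eventually.of_forall fun R => Eventually.of_forall fun y => ?_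
      gcongr
      exact Set.inter_subset_left
    · rw [lintegral_mul_const _ hF]
      exact ENNReal.mul_ne_top hF₁ hΩ.measure_lt_top.ne
    · have hfin : ∀ᵐ y ∂μ, F y < ∞ := ae_lt_top hF hF₁
      filter_upwards [hfin] with y hy
      have h0 : Tendsto (fun R : ℝ => R⁻¹ • y) atTop (𝓝 0) := by
        simpa using (tendsto_inv_atTop_zero (𝕜 := ℝ)).smul_const y
      have h1 := (hΩ.tendsto_measure_inter_add_notMem μ).comp h0
      simpa using ENNReal.Tendsto.const_mul h1 (Or.inr hy.ne)
  rw [lintegral_zero] at hlim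
  refine hlim.congr' ?_
  filter_upwards [eventually_gt_atTop 0] with R hR
  have hpos : ENNReal.ofReal (R ^ Module.finrank ℝ E) ≠ 0 := by
    rw [ENNReal.ofReal_ne_zero_iff]
    positivity
  have hmeas : MeasurableSet (R • Ω) := (hΩ.smul R).measurableSet
  rw [setLIntegral_setLIntegral_compl_sub μ hF hmeas]
  simp_rw [hscale R hR, mul_left_comm (F _)]
  rw [lintegral_const_mul' _ _ ENNReal.ofReal_ne_top, mul_comm,
    ENNReal.mul_div_cancel_right hpos ENNReal.ofReal_ne_top]

end Leakage

-- Instance search does not unfold the volume of a product to a product measure.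
instance QHA.isAddHaarMeasure_volume_phase (d : ℕ) :
    (volume : Measure (QHA.Phase d)).IsAddHaarMeasure :=
  inferInstanceAs ((volume : Measure (QHA.Config d)).prod volume).IsAddHaarMeasure

end

theorem mainTheorem4 (d : ℕ) (S : QHA.L2 d →L[ℂ] QHA.L2 d) (hS : QHA.IsDensityOperator S)
    (Ω : Set (QHA.Phase d)) (hΩ : IsCompact Ω) (hΩ₀ : volume Ω ≠ 0)
    (δ : ℝ) (hδ : δ ∈ Set.Ioo (0 : ℝ) 1) :
    (∀ R : ℝ, 0 < R → QHA.eigenvalueCount (QHA.locOp (R • Ω) (hΩ.smul R) S) (1 - δ) ≠ ∞) ∧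
    Tendsto (fun R : ℝ =>
        (QHA.eigenvalueCount (QHA.locOp (R • Ω) (hΩ.smul R) S) (1 - δ)).toReal
          / (R ^ (2 * d) * (volume Ω).toReal))
      atTop (𝓝 1) := by
  set e := (exists_hilbertBasis ℂ (QHA.L2 d)).choose_spec.choose
  obtain ⟨b, hb, hSb⟩ := e.exists_rankOne_decomposition hS.isPositive
  have := e.orthonormal.countable_of_separableSpace
  replace hb : ∑' k, ‖b k‖ₑ ^ 2 = 1 := hb.trans hS.trace_eq_one
  -- `F y = tr (S α_y(S))` is a probability density, by Moyal's identity.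
  set F : QHA.Phase d → ℝ≥0∞ := fun y => ∑' k, QHA.husimi S (b k) y with hF
  have hFm : Measurable F := Measurable.tsum fun k => QHA.measurable_husimi S (b k)
  have hF₁ : ∫⁻ y, F y = 1 := by
    rw [hF, lintegral_tsum fun k => (QHA.measurable_husimi S (b k)).aemeasurable]
    simp_rw [QHA.lintegral_husimi hSb hb]
    exact hb
  set C := ENNReal.ofReal (min δ (1 - δ))⁻¹
  set D : ℝ → ℝ≥0∞ := fun R => ∫⁻ z in R • Ω, ∫⁻ w in (R • Ω)ᶜ, F (w - z)
  set N : ℝ → ℝ≥0∞ := fun R =>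
    QHA.eigenvalueCount (QHA.locOp (R • Ω) (hΩ.smul R) S) (1 - δ)
  have hbound : ∀ R, N R ≤ volume (R • Ω) + C * D R ∧ volume (R • Ω) ≤ N R + C * D R := fun R =>
    QHA.eigenvalueCount_locOp_le_and_le hS.isPositive hSb hb (hΩ.smul R) hδ
  have hΩfin : volume Ω ≠ ∞ := hΩ.measure_lt_top.ne
  have hDfin : ∀ R, D R ≠ ∞ := fun R => by
    have hle : D R ≤ ∫⁻ z in R • Ω, 1 := by
      refine lintegral_mono fun z => (setLIntegral_le_lintegral _ _).trans ?_
      rw [lintegral_sub_right_eq_self F z, hF₁]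
    rw [setLIntegral_one] at hle
    exact ne_top_of_le_ne_top (hΩ.smul R).measure_lt_top.ne hle
  have hNfin : ∀ R, N R ≠ ∞ := fun R => ne_top_of_le_ne_top
    (ENNReal.add_ne_top.2 ⟨(hΩ.smul R).measure_lt_top.ne,
      ENNReal.mul_ne_top ENNReal.ofReal_ne_top (hDfin R)⟩) (hbound R).1
  refine ⟨fun R _ => hNfin R, ?_⟩
  have hdim : Module.finrank ℝ (QHA.Phase d) = 2 * d := by
    rw [Module.finrank_prod, finrank_euclideanSpace_fin, two_mul]
  have hV : 0 < (volume Ω).toReal := ENNReal.toReal_pos hΩ₀ hΩfin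
  have hlim := (ENNReal.tendsto_toReal ENNReal.zero_ne_top).comp
    (hΩ.tendsto_setLIntegral_compl_smul_div volume hFm (by rw [hF₁]; exact ENNReal.one_ne_top))
  rw [hdim, ENNReal.toReal_zero] at hlim
  have hlim' := hlim.const_mul (C.toReal / (volume Ω).toReal)
  rw [mul_zero] at hlim'
  rw [tendsto_iff_norm_sub_tendsto_zero]
  refine squeeze_zero' (Eventually.of_forall fun _ => norm_nonneg _) ?_ hlim'
  filter_upwards [eventually_gt_atTop 0] with R hR
  have hRd : 0 < R ^ (2 * d) := pow_pos hR _
  have hvol : (volume (R • Ω)).toReal = R ^ (2 * d) * (volume Ω).toReal := by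
    rw [Measure.addHaar_smul, hdim, ENNReal.toReal_mul, abs_of_pos hRd,
      ENNReal.toReal_ofReal hRd.le]
  have hCD : C * D R ≠ ∞ := ENNReal.mul_ne_top ENNReal.ofReal_ne_top (hDfin R)
  have h1 := ENNReal.toReal_mono (ENNReal.add_ne_top.2 ⟨(hΩ.smul R).measure_lt_top.ne, hCD⟩)
    (hbound R).1
  have h2 := ENNReal.toReal_mono (ENNReal.add_ne_top.2 ⟨hNfin R, hCD⟩) (hbound R).2
  rw [ENNReal.toReal_add (hΩ.smul R).measure_lt_top.ne hCD, ENNReal.toReal_mul, hvol] at h1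
  rw [ENNReal.toReal_add (hNfin R) hCD, ENNReal.toReal_mul, hvol] at h2
  have hDdiv : (D R / ENNReal.ofReal (R ^ (2 * d))).toReal = (D R).toReal / R ^ (2 * d) := by
    rw [ENNReal.toReal_div, ENNReal.toReal_ofReal hRd.le]
  change ‖(N R).toReal / _ - 1‖ ≤ _ * (D R / ENNReal.ofReal (R ^ (2 * d))).toReal
  rw [hDdiv, div_sub_one (mul_pos hRd hV).ne', Real.norm_eq_abs, abs_div,
    abs_of_pos (mul_pos hRd hV), div_mul_div_comm, mul_comm (volume Ω).toReal]
  gcongr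
  rw [abs_le]
  constructor <;> linarith
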